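/- For a non-negative integer $n$ let $$a_n(1,1)=\sum_{k=0}^n\binom nk\binom{n+k}k ,$$ let $n_0$ denote the $0$-th (least significant) digit in the ternary expansion of $n$, and let $\mu(n)$ denote the number of maximal strings of consecutive digits $2$ in the ternary expansion of $n$. Then, for every $n\ge 0$: 1. $a_n(1,1)\equiv 1\pmod 9$ if and only if the ternary expansion of $n$ contains only the digits $0$ and $2$, and $\mu(n)\equiv n_0\pmod 3$; 2. $a_n(1,1)\equiv 3\pmod 9$ if and only if $n_0=1$ and all other ternary digits of $n$ are $0$ or $2$; 3. $a_n(1,1)\equiv 4\pmod 9$ if and only if the ternary expansion of $n$ contains only the digits $0$ and $2$, and $\mu(n)\equiv n_0+2\pmod 3$; 4. $a_n(1,1)\equiv 6\pmod 9$ if and only if the ternary expansion of $n$ has exactly one occurrence of the string $11$ and otherwise contains only the digits $0$ and $2$; 5. $a_n(1,1)\equiv 7\pmod 9$ if and only if the ternary expansion of $n$ contains only the digits $0$ and $2$, and $\mu(n)\equiv n_0+1\pmod 3$; 6. if none of the conditions on the ternary expansion of $n$ in items 1-5 holds, then $a_n(1,1)$ is divisible by $9$; in particular, $a_n(1,1)\not\equiv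 2,5,8\pmod 9$ for all $n$. (The expansion of $n=0$ is regarded as containing only the digits $0$ and $2$.) -/

import Mathlib

/-- The (generalised) Apéry numbers `a_n(r, s) = ∑_{k=0}^n C(n,k)^r * C(n+k,k)^s`. -/
def aperyNumber (r s n : ℕ) : ℕ :=
  ∑ k ∈ Finset.range (n + 1), n.choose k ^ r * (n + k).choose k ^ s

/-- The digit `n_i` of `3^i` in the ternary expansion of `n` (it is `0` beyond the leading digit). -/
def ternaryDigit (n i : ℕ) : ℕ := (Nat.digits 3 n).getD i 0

/-- The ternary expansion of `n` contains only the digits `0` and `2`. -/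
def OnlyZerosAndTwos (n : ℕ) : Prop :=
  ∀ i, ternaryDigit n i = 0 ∨ ternaryDigit n i = 2

/-- The digits in the positions `i, i + 1, …, j` are all equal to `2`, and neither neighbouring
position holds a `2`: these positions form a maximal string of `2`'s. -/
abbrev IsMaximalStringOfTwos (n i j : ℕ) : Prop :=
  i ≤ j ∧ (∀ k ∈ Finset.Icc i j, ternaryDigit n k = 2) ∧
    (i = 0 ∨ ternaryDigit n (i - 1) ≠ 2) ∧ ternaryDigit n (j + 1) ≠ 2

/-- The number of maximal strings of `2`'s in the ternary expansion of `n`. -/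
def numMaximalStringsOfTwos (n : ℕ) : ℕ :=
  ((Finset.range (Nat.digits 3 n).length ×ˢ Finset.range (Nat.digits 3 n).length).filter
    fun p => IsMaximalStringOfTwos n p.1 p.2).card

/-- The `0`-th digit of `n` is `1` and all its other ternary digits are `0` or `2`. -/
def LastDigitOneOtherwiseZerosAndTwos (n : ℕ) : Prop :=
  ternaryDigit n 0 = 1 ∧ ∀ i, i ≠ 0 → ternaryDigit n i = 0 ∨ ternaryDigit n i = 2

/-- The string `11` occurs in the ternary expansion of `n` in the positions `i + 1, i`. -/
def OneOneOccursAt (n i : ℕ) : Prop :=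
  ternaryDigit n (i + 1) = 1 ∧ ternaryDigit n i = 1

/-- The ternary expansion of `n` has exactly one occurrence of the string `11`, and outside of this
occurrence it contains only the digits `0` and `2`. -/
def OneOneOnceOtherwiseZerosAndTwos (n : ℕ) : Prop :=
  ∃ i, OneOneOccursAt n i ∧ (∀ j, OneOneOccursAt n j → j = i) ∧
    ∀ j, j ≠ i → j ≠ i + 1 → ternaryDigit n j = 0 ∨ ternaryDigit n j = 2

/-! With `Q = (X + 1)(X + 2)`, the number `a_n(1,1)` is the coefficient of `X ^ n` in `Q ^ n`.
Modulo 3, `Q ^ 3` is `Q(X ^ 3)`; cubing gives `Q ^ 9 = Q(X ^ 3) ^ 3` modulo 9. Hence `Q ^ (3 * (3 *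
m + i))` is `Q ^ (3 * m)` evaluated at `X ^ 3`, times `Q ^ (3 * i)`, and its coefficients near the
centre depend only on those of `Q ^ (3 * m)` near the centre. A window of five coefficients is
closed under this passage (`centralCoeffs_three_mul_add`), so appending a ternary digit acts on it
by a linear map, `digitStep`.

From `(0, 0, 1, 0, 0)` these maps reach only vectors of four shapes, matched with digit patterns by
induction in `hasExpectedCoeffs`. Multiplying `Q ^ (3 * m)` by `Q ^ i` then reads off `a_n` for `n =
3 * m + i`. -/

open Polynomial

/-! ### Central Delannoy numbers as polynomial coefficients -/

/-- The polynomial `X ^ 2 + 3 X + 2`, whose `n`-th power has the `n`-th coefficient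
`aperyNumber 1 1 n`. -/
noncomputable def delannoyPoly (R : Type*) [CommRing R] : R[X] := X ^ 2 + 3 * X + 2

/-- Expand the second factor of `(X + 1) * ((X + 1) + 1)` binomially in powers of `X + 1`. -/
theorem coeff_delannoyPoly_pow {R : Type*} [CommRing R] (n : ℕ) :
    (delannoyPoly R ^ n).coeff n = (aperyNumber 1 1 n : R) := by
  have h : delannoyPoly R ^ n
      = ∑ k ∈ Finset.range (n + 1), (n.choose k : R[X]) * (X + 1) ^ (n + k) := by
    have : delannoyPoly R = (X + 1) * ((X + 1) + 1) := by unfold delannoyPoly; ring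
    rw [this, mul_pow, add_pow (X + 1 : R[X]) 1, Finset.mul_sum]
    refine Finset.sum_congr rfl fun k _ => ?_
    rw [pow_add]
    ring
  rw [h, finsetSum_coeff, aperyNumber, Nat.cast_sum]
  refine Finset.sum_congr rfl fun k _ => ?_
  rw [← C_eq_natCast, coeff_C_mul, coeff_X_add_one_pow, pow_one, pow_one, Nat.cast_mul,
    Nat.choose_symm_add]

/-! ### Recursion modulo nine -/

theorem nine_eq_zero : (9 : (ZMod 9)[X]) = 0 := by
  rw [← C_ofNat, show (OfNat.ofNat 9 : ZMod 9) = 0 by decide, C_0]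

local notation "Q" => delannoyPoly (ZMod 9)

theorem delannoyPoly_pow_three : Q ^ 3 = X ^ 6 + 6 * X ^ 4 + 3 * X ^ 2 + 8 := by
  unfold delannoyPoly
  -- The multiplier of `nine_eq_zero` is the difference of the two sides over the integers, divided
  -- by 9; likewise below.
  linear_combination (X ^ 5 + 3 * X ^ 4 + 7 * X ^ 3 + 7 * X ^ 2 + 4 * X) * nine_eq_zero

theorem delannoyPoly_pow_six :
    Q ^ 6 = X ^ 12 + 3 * X ^ 10 + 6 * X ^ 8 + 7 * X ^ 6 + 6 * X ^ 4 + 3 * X ^ 2 + 1 := by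
  rw [show Q ^ 6 = (Q ^ 3) ^ 2 by ring, delannoyPoly_pow_three]
  linear_combination (X ^ 10 + 4 * X ^ 8 + 5 * X ^ 6 + 11 * X ^ 4 + 5 * X ^ 2 + 7) * nine_eq_zero

theorem delannoyPoly_pow_nine_mul (m : ℕ) : Q ^ (9 * m) = expand (ZMod 9) 3 (Q ^ (3 * m)) := by
  have h : Q ^ 9 = expand (ZMod 9) 3 Q ^ 3 := by
    have h1 : expand (ZMod 9) 3 Q = X ^ 6 + 3 * X ^ 3 + 2 := by
      simp only [delannoyPoly, map_add, map_mul, map_pow, expand_X, map_ofNat]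
      ring
    -- This is `Q ^ 3 = e + 3 * r` with `e = Q(X ^ 3)`; every term of its cube other than `e ^ 3` is
    -- divisible by 9.
    have h2 : Q ^ 3 = (X ^ 6 + 3 * X ^ 3 + 2)
        + 3 * (3 * X ^ 5 + 11 * X ^ 4 + 20 * X ^ 3 + 22 * X ^ 2 + 12 * X + 2) := by
      unfold delannoyPoly
      ring
    rw [h1, show 9 = 3 * 3 from rfl, pow_mul, h2]
    generalize (3 * X ^ 5 + 11 * X ^ 4 + 20 * X ^ 3 + 22 * X ^ 2 + 12 * X + 2 : (ZMod 9)[X]) = r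
    generalize (X ^ 6 + 3 * X ^ 3 + 2 : (ZMod 9)[X]) = e
    linear_combination (e ^ 2 * r + 3 * e * r ^ 2 + 3 * r ^ 3) * nine_eq_zero
  rw [pow_mul, h, ← pow_mul, map_pow]

theorem coeff_expand_mul_X_pow {R : Type*} [CommRing R] {p : ℕ} (hp : 0 < p) (f : R[X])
    (k t : ℕ) : (expand R p f * X ^ (p * k)).coeff (p * t) = (f * X ^ k).coeff t := by
  have h : expand R p f * X ^ (p * k) = expand R p (f * X ^ k) := by
    rw [map_mul, map_pow, expand_X, pow_mul]
  rw [h, coeff_expand_mul' hp]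

theorem coeff_expand_mul_X_pow_eq_zero {R : Type*} [CommRing R] {p : ℕ} (hp : 0 < p)
    (f : R[X]) {k : ℕ} (hk : ¬ p ∣ k) (t : ℕ) :
    (expand R p f * X ^ k).coeff (p * t) = 0 := by
  rw [coeff_mul_X_pow']
  split_ifs with h
  · rw [coeff_expand hp, if_neg]
    intro hd
    apply hk
    have := Nat.dvd_sub (Dvd.intro t rfl : p ∣ p * t) hd
    rwa [Nat.sub_sub_self h] at this
  · rfl

/-- The coefficient of `X ^ (3 * m + 3 - b)` in `Q ^ (3 * m)`. -/
noncomputable def shiftedCoeff (m b : ℕ) : ZMod 9 := (Q ^ (3 * m) * X ^ b).coeff (3 * m + 3)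

/-- The contribution of a monomial `X ^ k` of `Q ^ (3 * i) * X ^ b` to
`shiftedCoeff (3 * m + i) b`. -/
noncomputable def sectionCoeff (m i k : ℕ) : ZMod 9 :=
  (expand (ZMod 9) 3 (Q ^ (3 * m)) * X ^ k).coeff (3 * (3 * m + i + 1))

theorem sectionCoeff_three_mul (m i k : ℕ) (hi : i ≤ 2) :
    sectionCoeff m i (3 * k) = shiftedCoeff m (k + (2 - i)) := by
  rw [sectionCoeff, coeff_expand_mul_X_pow (by norm_num), shiftedCoeff, pow_add, ← mul_assoc,
    show 3 * m + 3 = 3 * m + i + 1 + (2 - i) by omega, coeff_mul_X_pow]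

theorem sectionCoeff_eq_zero (m i k : ℕ) (hk : ¬ 3 ∣ k) : sectionCoeff m i k = 0 :=
  coeff_expand_mul_X_pow_eq_zero (by norm_num) _ hk _

theorem shiftedCoeff_three_mul_add (m i b : ℕ) :
    shiftedCoeff (3 * m + i) b
      = (expand (ZMod 9) 3 (Q ^ (3 * m)) * (Q ^ (3 * i) * X ^ b)).coeff
          (3 * (3 * m + i + 1)) := by
  rw [shiftedCoeff, show 3 * (3 * m + i) = 9 * m + 3 * i by ring, pow_add,
    delannoyPoly_pow_nine_mul, mul_assoc,
    show 3 * (3 * m + i + 1) = 9 * m + 3 * i + 3 by ring]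

theorem shiftedCoeff_three_mul (m b : ℕ) : shiftedCoeff (3 * m) b = sectionCoeff m 0 b := by
  have := shiftedCoeff_three_mul_add m 0 b
  simpa [sectionCoeff] using this

theorem shiftedCoeff_three_mul_add_one (m b : ℕ) :
    shiftedCoeff (3 * m + 1) b = sectionCoeff m 1 (b + 6) + 6 * sectionCoeff m 1 (b + 4)
      + 3 * sectionCoeff m 1 (b + 2) + 8 * sectionCoeff m 1 b := by
  rw [shiftedCoeff_three_mul_add, mul_one, delannoyPoly_pow_three]
  have h (e : (ZMod 9)[X]) :
      e * ((X ^ 6 + 6 * X ^ 4 + 3 * X ^ 2 + 8) * X ^ b)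
        = e * X ^ (b + 6) + 6 * (e * X ^ (b + 4)) + 3 * (e * X ^ (b + 2)) + 8 * (e * X ^ b) := by
    ring
  simp only [h, sectionCoeff, coeff_add, coeff_ofNat_mul]

theorem shiftedCoeff_three_mul_add_two (m b : ℕ) :
    shiftedCoeff (3 * m + 2) b = sectionCoeff m 2 (b + 12) + 3 * sectionCoeff m 2 (b + 10)
      + 6 * sectionCoeff m 2 (b + 8) + 7 * sectionCoeff m 2 (b + 6)
      + 6 * sectionCoeff m 2 (b + 4) + 3 * sectionCoeff m 2 (b + 2) + sectionCoeff m 2 b := by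
  rw [shiftedCoeff_three_mul_add, show 3 * 2 = 6 from rfl, delannoyPoly_pow_six]
  have h (e : (ZMod 9)[X]) :
      e * ((X ^ 12 + 3 * X ^ 10 + 6 * X ^ 8 + 7 * X ^ 6 + 6 * X ^ 4 + 3 * X ^ 2 + 1) * X ^ b)
        = e * X ^ (b + 12) + 3 * (e * X ^ (b + 10)) + 6 * (e * X ^ (b + 8)) + 7 * (e * X ^ (b + 6)) + 6 * (e * X ^ (b + 4)) + 3 * (e * X ^ (b + 2)) + e * X ^ b := by
    ring
  simp only [h, sectionCoeff, coeff_add, coeff_ofNat_mul]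

/-- The five coefficients of `Q ^ (3 * m)` around the central one. -/
noncomputable def centralCoeffs (m : ℕ) : Fin 5 → ZMod 9 := fun j => shiftedCoeff m (j + 1)

theorem centralCoeffs_zero : centralCoeffs 0 = ![0, 0, 1, 0, 0] := by
  funext j
  fin_cases j <;> simp [centralCoeffs, shiftedCoeff, coeff_X_pow, coeff_X]

/-- The effect on `centralCoeffs` of appending the ternary digit `i`. -/
def digitStep (i : ℕ) (v : Fin 5 → ZMod 9) : Fin 5 → ZMod 9 :=
  if i = 0 then ![0, 0, v 2, 0, 0]
  else if i = 1 then ![3 * v 1, 6 * v 2, 8 * v 1 + v 3, 3 * v 2, 6 * v 3]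
  else ![3 * v 0 + 6 * v 2, 6 * v 1 + 3 * v 3, v 0 + 7 * v 2 + v 4, 3 * v 1 + 6 * v 3,
    6 * v 2 + 3 * v 4]

/-- The window is closed: for `1 ≤ b ≤ 5` and a monomial `X ^ k` of `Q ^ (3 * i)`, only `3 ∣ b + k`
contributes, with new shift `(b + k) / 3 + 2 - i`. Since `k ≤ 6 * i`, this again lies between 1 and
5. -/
theorem centralCoeffs_three_mul_add (m i : ℕ) (hi : i < 3) :
    centralCoeffs (3 * m + i) = digitStep i (centralCoeffs m) := by
  have h3 (i : ℕ) (hi : i ≤ 2) := sectionCoeff_three_mul m i 1 hi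
  have h6 (i : ℕ) (hi : i ≤ 2) := sectionCoeff_three_mul m i 2 hi
  have h9 (i : ℕ) (hi : i ≤ 2) := sectionCoeff_three_mul m i 3 hi
  have h12 (i : ℕ) (hi : i ≤ 2) := sectionCoeff_three_mul m i 4 hi
  have h15 (i : ℕ) (hi : i ≤ 2) := sectionCoeff_three_mul m i 5 hi
  norm_num only at h3 h6 h9 h12 h15
  funext j
  interval_cases i <;> fin_cases j <;>
    simp [centralCoeffs, digitStep, shiftedCoeff_three_mul, shiftedCoeff_three_mul_add_one,
      shiftedCoeff_three_mul_add_two, h3, h6, h9, h12, h15, sectionCoeff_eq_zero] <;> ring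

/-- For `i ≤ 2` the exponents in `Q ^ i * X ^ (3 - i)` lie between 1 and 5, so the five central
coefficients suffice. -/
theorem aperyNumber_three_mul_add (m i : ℕ) (hi : i ≤ 3) :
    (aperyNumber 1 1 (3 * m + i) : ZMod 9)
      = (Q ^ (3 * m) * (Q ^ i * X ^ (3 - i))).coeff (3 * m + 3) := by
  rw [← coeff_delannoyPoly_pow, pow_add, ← mul_assoc,
    show 3 * m + 3 = 3 * m + i + (3 - i) by omega, coeff_mul_X_pow]

theorem aperyNumber_three_mul (m : ℕ) :
    (aperyNumber 1 1 (3 * m) : ZMod 9) = centralCoeffs m 2 := by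
  simpa [centralCoeffs, shiftedCoeff] using aperyNumber_three_mul_add m 0 (by norm_num)

theorem aperyNumber_three_mul_add_one (m : ℕ) :
    (aperyNumber 1 1 (3 * m + 1) : ZMod 9)
      = 2 * centralCoeffs m 1 + 3 * centralCoeffs m 2 + centralCoeffs m 3 := by
  rw [aperyNumber_three_mul_add m 1 (by norm_num)]
  have h (e : (ZMod 9)[X]) : e * (Q ^ 1 * X ^ (3 - 1))
      = 2 * (e * X ^ 2) + 3 * (e * X ^ 3) + e * X ^ 4 := by
    unfold delannoyPoly
    ring
  rw [h]
  simp only [coeff_add, coeff_ofNat_mul]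
  rfl

theorem aperyNumber_three_mul_add_two (m : ℕ) :
    (aperyNumber 1 1 (3 * m + 2) : ZMod 9)
      = 4 * centralCoeffs m 0 + 12 * centralCoeffs m 1 + 13 * centralCoeffs m 2
        + 6 * centralCoeffs m 3 + centralCoeffs m 4 := by
  rw [aperyNumber_three_mul_add m 2 (by norm_num)]
  have h (e : (ZMod 9)[X]) : e * (Q ^ 2 * X ^ (3 - 2))
      = 4 * (e * X ^ 1) + 12 * (e * X ^ 2) + 13 * (e * X ^ 3) + 6 * (e * X ^ 4) + e * X ^ 5 := by
    unfold delannoyPoly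
    ring
  rw [h]
  simp only [coeff_add, coeff_ofNat_mul]
  rfl

/-! ### Ternary digits -/

theorem ternaryDigit_eq (n i : ℕ) : ternaryDigit n i = n / 3 ^ i % 3 :=
  Nat.getD_digits n i (by norm_num)

theorem ternaryDigit_zero_right (m i : ℕ) (hi : i < 3) : ternaryDigit (3 * m + i) 0 = i := by
  rw [ternaryDigit_eq, pow_zero]
  omega

theorem ternaryDigit_succ (m i k : ℕ) (hi : i < 3) :
    ternaryDigit (3 * m + i) (k + 1) = ternaryDigit m k := by
  rw [ternaryDigit_eq, ternaryDigit_eq, pow_succ', ← Nat.div_div_eq_div_mul]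
  congr 2
  omega

theorem ternaryDigit_eq_zero {n i : ℕ} (h : (Nat.digits 3 n).length ≤ i) :
    ternaryDigit n i = 0 := List.getD_eq_default _ _ h

theorem onlyZerosAndTwos_three_mul_add (m i : ℕ) (hi : i < 3) :
    OnlyZerosAndTwos (3 * m + i) ↔ (i = 0 ∨ i = 2) ∧ OnlyZerosAndTwos m := by
  simp only [OnlyZerosAndTwos]
  rw [Nat.and_forall_add_one.symm]
  simp only [ternaryDigit_zero_right m i hi, ternaryDigit_succ m i _ hi]

theorem lastDigitOne_three_mul_add (m i : ℕ) (hi : i < 3) :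
    LastDigitOneOtherwiseZerosAndTwos (3 * m + i) ↔ i = 1 ∧ OnlyZerosAndTwos m := by
  simp only [LastDigitOneOtherwiseZerosAndTwos, OnlyZerosAndTwos]
  rw [← Nat.and_forall_add_one (p := fun j => j ≠ 0 → _)]
  simp [ternaryDigit_zero_right m i hi, ternaryDigit_succ m i _ hi]

/-- Uniqueness is automatic: a second occurrence at `j` needs both `j` and `j + 1` in `{i, i + 1}`,
so `j = i`. -/
theorem oneOneOnce_iff (n : ℕ) : OneOneOnceOtherwiseZerosAndTwos n ↔
    ∃ i, OneOneOccursAt n i ∧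
      ∀ j, j ≠ i → j ≠ i + 1 → ternaryDigit n j = 0 ∨ ternaryDigit n j = 2 := by
  refine exists_congr fun i => and_congr_right fun _ => and_iff_right_of_imp fun h j hj => ?_
  have h1 : j = i ∨ j = i + 1 := by
    by_contra! hc
    have := h j hc.1 hc.2
    have := hj.2
    omega
  have h2 : j + 1 = i ∨ j + 1 = i + 1 := by
    by_contra! hc
    have := h (j + 1) hc.1 hc.2
    have := hj.1
    omega
  omega

theorem oneOneOnce_three_mul_add (m i : ℕ) (hi : i < 3) :
    OneOneOnceOtherwiseZerosAndTwos (3 * m + i) ↔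
      (i = 1 ∧ LastDigitOneOtherwiseZerosAndTwos m) ∨
        ((i = 0 ∨ i = 2) ∧ OneOneOnceOtherwiseZerosAndTwos m) := by
  rw [oneOneOnce_iff, oneOneOnce_iff, ← Nat.or_exists_add_one]
  refine or_congr ?_ ?_
  · simp only [OneOneOccursAt, LastDigitOneOtherwiseZerosAndTwos,
      ternaryDigit_zero_right m i hi, ternaryDigit_succ m i _ hi]
    constructor
    · rintro ⟨⟨h1, h2⟩, h3⟩
      refine ⟨h2, h1, fun j hj => ?_⟩
      rw [← ternaryDigit_succ m i j hi]
      exact h3 _ (by omega) (by omega)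
    · rintro ⟨h2, h1, h3⟩
      refine ⟨⟨h1, h2⟩, fun j hj hj' => ?_⟩
      obtain ⟨j, rfl⟩ := Nat.exists_eq_succ_of_ne_zero hj
      rw [Nat.succ_eq_add_one, ternaryDigit_succ m i j hi]
      exact h3 _ (by omega)
  · rw [← exists_and_left]
    refine exists_congr fun k => ?_
    simp only [OneOneOccursAt, ternaryDigit_succ m i _ hi]
    rw [← Nat.and_forall_add_one (p := fun j => j ≠ k + 1 → _)]
    simp only [ternaryDigit_zero_right m i hi, ternaryDigit_succ m i _ hi]
    constructor
    · rintro ⟨h, h0, h1⟩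
      exact ⟨h0 (by omega) (by omega), h, fun j hj hj' => h1 j (by omega) (by omega)⟩
    · rintro ⟨h0, h, h1⟩
      exact ⟨h, fun _ _ => h0, fun j hj hj' => h1 j (by omega) (by omega)⟩

/-! ### Counting maximal strings of twos -/

theorem exists_start_of_twos {n j : ℕ} (h2 : ternaryDigit n j = 2)
    (h3 : ternaryDigit n (j + 1) ≠ 2) : ∃ i, IsMaximalStringOfTwos n i j := by
  have hex : ∃ i, i ≤ j ∧ ∀ k ∈ Finset.Icc i j, ternaryDigit n k = 2 :=
    ⟨j, le_rfl, fun k hk => by rw [Finset.mem_Icc] at hk; rwa [show k = j by omega]⟩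
  classical
  obtain ⟨hle, hall⟩ := Nat.find_spec hex
  refine ⟨Nat.find hex, hle, hall, ?_, h3⟩
  by_contra! hc
  refine Nat.find_min hex (m := Nat.find hex - 1) (by omega) ⟨by omega, fun k hk => ?_⟩
  rw [Finset.mem_Icc] at hk
  rcases eq_or_ne k (Nat.find hex - 1) with rfl | hne
  · exact hc.2
  · exact hall k (Finset.mem_Icc.2 (by omega))

theorem IsMaximalStringOfTwos.start_le {n i i' j : ℕ} (h : IsMaximalStringOfTwos n i j)
    (h' : IsMaximalStringOfTwos n i' j) : i ≤ i' := by
  by_contra! hlt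
  rcases h.2.2.1 with h0 | h0
  · omega
  · have := h.1
    exact h0 (h'.2.1 _ (Finset.mem_Icc.2 (by omega)))

/-- A maximal string is determined by its most significant position. The bound `N` is left free so
that expansions of different lengths can be compared. -/
theorem numMaximalStringsOfTwos_eq (n : ℕ) {N : ℕ} (hN : (Nat.digits 3 n).length ≤ N) :
    numMaximalStringsOfTwos n = ∑ j ∈ Finset.range N,
      if ternaryDigit n j = 2 ∧ ternaryDigit n (j + 1) ≠ 2 then 1 else 0 := by
  have hlt {j : ℕ} (h : ternaryDigit n j = 2) : j < (Nat.digits 3 n).length := by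
    by_contra! hc
    have := ternaryDigit_eq_zero hc
    omega
  rw [← Finset.card_filter, numMaximalStringsOfTwos]
  refine Finset.card_bij (fun p _ => p.2) ?_ ?_ ?_
  · rintro ⟨i, j⟩ hp
    rw [Finset.mem_filter] at hp
    have hj := hp.2.2.1 j (Finset.mem_Icc.2 ⟨hp.2.1, le_rfl⟩)
    exact Finset.mem_filter.2 ⟨Finset.mem_range.2 ((hlt hj).trans_le hN), hj, hp.2.2.2.2⟩
  · rintro ⟨i, j⟩ hp ⟨i', j'⟩ hp' (rfl : j = j')
    have h := (Finset.mem_filter.1 hp).2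
    have h' := (Finset.mem_filter.1 hp').2
    exact Prod.ext (le_antisymm (h.start_le h') (h'.start_le h)) rfl
  · intro j hj
    obtain ⟨-, h2, h3⟩ := Finset.mem_filter.1 hj
    obtain ⟨i, hi⟩ := exists_start_of_twos h2 h3
    refine ⟨(i, j), Finset.mem_filter.2 ⟨Finset.mem_product.2 ⟨?_, ?_⟩, hi⟩, rfl⟩
    · exact Finset.mem_range.2 (hi.1.trans_lt (hlt h2))
    · exact Finset.mem_range.2 (hlt h2)

theorem numMaximalStringsOfTwos_three_mul_add (m i : ℕ) (hi : i < 3) :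
    numMaximalStringsOfTwos (3 * m + i) = numMaximalStringsOfTwos m
      + if i = 2 ∧ ternaryDigit m 0 ≠ 2 then 1 else 0 := by
  set N := (Nat.digits 3 m).length + (Nat.digits 3 (3 * m + i)).length
  rw [numMaximalStringsOfTwos_eq (3 * m + i) (N := N + 1) (by omega),
    numMaximalStringsOfTwos_eq m (N := N) (by omega), Finset.sum_range_succ']
  simp only [ternaryDigit_zero_right m i hi, ternaryDigit_succ m i _ hi]

/-! ### Classification -/

/-- The value of `centralCoeffs` according to the ternary expansion. -/
def HasExpectedCoeffs (m : ℕ) : Prop :=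
  (OnlyZerosAndTwos m → centralCoeffs m =
    ![3 * (ternaryDigit m 0 : ZMod 9), 0, 1 + 6 * (numMaximalStringsOfTwos m : ZMod 9), 0,
      3 * (ternaryDigit m 0 : ZMod 9)]) ∧
  (LastDigitOneOtherwiseZerosAndTwos m → centralCoeffs m = ![0, 6, 0, 3, 0]) ∧
  (OneOneOnceOtherwiseZerosAndTwos m → centralCoeffs m = ![0, 0, 6, 0, 0]) ∧
  (¬ OnlyZerosAndTwos m → ¬ LastDigitOneOtherwiseZerosAndTwos m →
    ¬ OneOneOnceOtherwiseZerosAndTwos m → centralCoeffs m = ![0, 0, 0, 0, 0])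

theorem hasExpectedCoeffs_zero : HasExpectedCoeffs 0 := by
  have hd (i : ℕ) : ternaryDigit 0 i = 0 := ternaryDigit_eq_zero (by simp)
  have hO : OnlyZerosAndTwos 0 := fun i => Or.inl (hd i)
  refine ⟨fun _ => ?_, fun h => ?_, fun ⟨i, h, _⟩ => ?_, fun h => absurd hO h⟩
  · simp [centralCoeffs_zero, hd, numMaximalStringsOfTwos]
  · simpa [hd] using h.1
  · simpa [hd] using h.1

theorem HasExpectedCoeffs.three_mul_add {m : ℕ} (h : HasExpectedCoeffs m) (i : ℕ) (hi : i < 3) :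
    HasExpectedCoeffs (3 * m + i) := by
  obtain ⟨hO, hT, hE, hN⟩ := h
  simp only [HasExpectedCoeffs, centralCoeffs_three_mul_add m i hi,
    onlyZerosAndTwos_three_mul_add m i hi, lastDigitOne_three_mul_add m i hi,
    oneOneOnce_three_mul_add m i hi, ternaryDigit_zero_right m i hi,
    numMaximalStringsOfTwos_three_mul_add m i hi]
  refine ⟨?_, ?_, ?_, ?_⟩
  · rintro ⟨rfl | rfl, h⟩
    · simp [hO h, digitStep]
    · rcases h 0 with h0 | h0
      · simp [hO h, digitStep, h0]
        generalize (numMaximalStringsOfTwos m : ZMod 9) = x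
        revert x
        decide
      · simp [hO h, digitStep, h0]
        generalize (numMaximalStringsOfTwos m : ZMod 9) = x
        revert x
        decide
  · rintro ⟨rfl, h⟩
    -- The string count drops out here, as `6 * (1 + 6 * μ) = 6` and `3 * (1 + 6 * μ) = 3` modulo 9.
    simp [hO h, digitStep]
    generalize (numMaximalStringsOfTwos m : ZMod 9) = x
    revert x
    decide
  · rintro (⟨rfl, h⟩ | ⟨rfl | rfl, h⟩)
    · simp [hT h, digitStep]
      decide
    · simp [hE h, digitStep]
    · simp [hE h, digitStep]
      decide
  · intro h1 h2 h3
    by_cases h4 : OnlyZerosAndTwos m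
    · have : i = 0 ∨ i = 1 ∨ i = 2 := by omega
      tauto
    by_cases h5 : LastDigitOneOtherwiseZerosAndTwos m
    · have : i = 0 ∨ i = 2 := by
        by_contra! hc
        exact h3 (Or.inl ⟨by omega, h5⟩)
      rw [hT h5]
      rcases this with rfl | rfl <;> decide
    by_cases h6 : OneOneOnceOtherwiseZerosAndTwos m
    · have : i = 1 := by
        by_contra! hc
        exact h3 (Or.inr ⟨by omega, h6⟩)
      rw [hE h6, this]
      decide
    rw [hN h4 h5 h6]
    interval_cases i <;> decide

theorem hasExpectedCoeffs (m : ℕ) : HasExpectedCoeffs m := by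
  induction m using Nat.strong_induction_on with
  | _ m ih =>
    rcases Nat.eq_zero_or_pos m with rfl | hm
    · exact hasExpectedCoeffs_zero
    · have := (ih (m / 3) (by omega)).three_mul_add (m % 3) (Nat.mod_lt _ (by norm_num))
      rwa [Nat.div_add_mod] at this

theorem aperyNumber_zmod_nine (n : ℕ) :
    (OnlyZerosAndTwos n → (aperyNumber 1 1 n : ZMod 9) =
      1 + 6 * (numMaximalStringsOfTwos n : ZMod 9) + 3 * (ternaryDigit n 0 : ZMod 9)) ∧
    (LastDigitOneOtherwiseZerosAndTwos n → (aperyNumber 1 1 n : ZMod 9) = 3) ∧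
    (OneOneOnceOtherwiseZerosAndTwos n → (aperyNumber 1 1 n : ZMod 9) = 6) ∧
    (¬ OnlyZerosAndTwos n → ¬ LastDigitOneOtherwiseZerosAndTwos n →
      ¬ OneOneOnceOtherwiseZerosAndTwos n → (aperyNumber 1 1 n : ZMod 9) = 0) := by
  obtain ⟨m, i, hi, rfl⟩ : ∃ m i, i < 3 ∧ n = 3 * m + i :=
    ⟨n / 3, n % 3, Nat.mod_lt _ (by norm_num), (Nat.div_add_mod n 3).symm⟩
  obtain ⟨hO, hT, hE, hN⟩ := hasExpectedCoeffs m
  simp only [onlyZerosAndTwos_three_mul_add m i hi, lastDigitOne_three_mul_add m i hi,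
    oneOneOnce_three_mul_add m i hi, ternaryDigit_zero_right m i hi,
    numMaximalStringsOfTwos_three_mul_add m i hi]
  refine ⟨?_, ?_, ?_, ?_⟩
  · rintro ⟨rfl | rfl, h⟩
    · simp [aperyNumber_three_mul, hO h]
    · rcases h 0 with h0 | h0
      · simp [aperyNumber_three_mul_add_two, hO h, h0]
        generalize (numMaximalStringsOfTwos m : ZMod 9) = x
        revert x
        decide
      · simp [aperyNumber_three_mul_add_two, hO h, h0]
        generalize (numMaximalStringsOfTwos m : ZMod 9) = x
        revert x
        decide
  · rintro ⟨rfl, h⟩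
    simp [aperyNumber_three_mul_add_one, hO h]
    generalize (numMaximalStringsOfTwos m : ZMod 9) = x
    revert x
    decide
  · rintro (⟨rfl, h⟩ | ⟨rfl | rfl, h⟩)
    · simp [aperyNumber_three_mul_add_one, hT h]
      decide
    · simp [aperyNumber_three_mul, hE h]
    · simp [aperyNumber_three_mul_add_two, hE h]
      decide
  · intro h1 h2 h3
    by_cases h4 : OnlyZerosAndTwos m
    · have : i = 0 ∨ i = 1 ∨ i = 2 := by omega
      tauto
    by_cases h5 : LastDigitOneOtherwiseZerosAndTwos m
    · have : i = 0 ∨ i = 2 := by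
        by_contra! hc
        exact h3 (Or.inl ⟨by omega, h5⟩)
      rcases this with rfl | rfl
      · rw [add_zero, aperyNumber_three_mul, hT h5]
        decide
      · rw [aperyNumber_three_mul_add_two, hT h5]
        decide
    by_cases h6 : OneOneOnceOtherwiseZerosAndTwos m
    · have : i = 1 := by
        by_contra! hc
        exact h3 (Or.inr ⟨by omega, h6⟩)
      rw [this, aperyNumber_three_mul_add_one, hE h6]
      decide
    interval_cases i
    · rw [add_zero, aperyNumber_three_mul, hN h4 h5 h6]
      decide
    · rw [aperyNumber_three_mul_add_one, hN h4 h5 h6]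
      decide
    · rw [aperyNumber_three_mul_add_two, hN h4 h5 h6]
      decide

theorem mainTheorem8 (n : ℕ) :
    (aperyNumber 1 1 n ≡ 1 [MOD 9] ↔
      OnlyZerosAndTwos n ∧ numMaximalStringsOfTwos n ≡ ternaryDigit n 0 [MOD 3]) ∧
    (aperyNumber 1 1 n ≡ 3 [MOD 9] ↔ LastDigitOneOtherwiseZerosAndTwos n) ∧
    (aperyNumber 1 1 n ≡ 4 [MOD 9] ↔
      OnlyZerosAndTwos n ∧ numMaximalStringsOfTwos n ≡ ternaryDigit n 0 + 2 [MOD 3]) ∧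
    (aperyNumber 1 1 n ≡ 6 [MOD 9] ↔ OneOneOnceOtherwiseZerosAndTwos n) ∧
    (aperyNumber 1 1 n ≡ 7 [MOD 9] ↔
      OnlyZerosAndTwos n ∧ numMaximalStringsOfTwos n ≡ ternaryDigit n 0 + 1 [MOD 3]) ∧
    (¬ (OnlyZerosAndTwos n ∧ numMaximalStringsOfTwos n ≡ ternaryDigit n 0 [MOD 3]) →
      ¬ LastDigitOneOtherwiseZerosAndTwos n →
      ¬ (OnlyZerosAndTwos n ∧ numMaximalStringsOfTwos n ≡ ternaryDigit n 0 + 2 [MOD 3]) →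
      ¬ OneOneOnceOtherwiseZerosAndTwos n →
      ¬ (OnlyZerosAndTwos n ∧ numMaximalStringsOfTwos n ≡ ternaryDigit n 0 + 1 [MOD 3]) →
      9 ∣ aperyNumber 1 1 n) ∧
    (¬ aperyNumber 1 1 n ≡ 2 [MOD 9] ∧ ¬ aperyNumber 1 1 n ≡ 5 [MOD 9] ∧
      ¬ aperyNumber 1 1 n ≡ 8 [MOD 9]) := by
  obtain ⟨hO, hT, hE, hN⟩ := aperyNumber_zmod_nine n
  have hO' (h : OnlyZerosAndTwos n) : aperyNumber 1 1 n
      ≡ 1 + 6 * numMaximalStringsOfTwos n + 3 * ternaryDigit n 0 [MOD 9] :=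
    (ZMod.natCast_eq_natCast_iff _ _ 9).1 (by rw [hO h]; push_cast; rfl)
  have hT' (h : LastDigitOneOtherwiseZerosAndTwos n) : aperyNumber 1 1 n ≡ 3 [MOD 9] :=
    (ZMod.natCast_eq_natCast_iff _ _ 9).1 (hT h)
  have hE' (h : OneOneOnceOtherwiseZerosAndTwos n) : aperyNumber 1 1 n ≡ 6 [MOD 9] :=
    (ZMod.natCast_eq_natCast_iff _ _ 9).1 (hE h)
  have hN' (h1 : ¬ OnlyZerosAndTwos n) (h2 : ¬ LastDigitOneOtherwiseZerosAndTwos n)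
      (h3 : ¬ OneOneOnceOtherwiseZerosAndTwos n) : aperyNumber 1 1 n ≡ 0 [MOD 9] :=
    (ZMod.natCast_eq_natCast_iff _ _ 9).1 (by rw [hN h1 h2 h3, Nat.cast_zero])
  clear hO hT hE hN
  simp only [Nat.ModEq, Nat.dvd_iff_mod_eq_zero] at *
  generalize aperyNumber 1 1 n = a at *
  generalize numMaximalStringsOfTwos n = μ at *
  generalize ternaryDigit n 0 = d at *
  -- The three patterns exclude one another because their residues differ: 1 modulo 3, then 3 and 6
  -- modulo 9. In the first, `1 + 6 * μ + 3 * d` depends only on `μ - d` modulo 3.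
  by_cases h1 : OnlyZerosAndTwos n <;>
    by_cases h2 : LastDigitOneOtherwiseZerosAndTwos n <;>
    by_cases h3 : OneOneOnceOtherwiseZerosAndTwos n <;>
    simp only [h1, h2, h3, not_true_eq_false, not_false_eq_true, true_imp_iff, false_imp_iff,
      true_and, false_and, implies_true, iff_true, iff_false] at * <;>
    and_intros <;> intros <;> omega
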